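/- Write $\widehat f$ for the Fourier transform on $L^2(\mathbb R)$, the unitary extension of $\widehat f(\xi)=\int_{\mathbb R}f(x)e^{-2i\pi x\xi}\,dx$; inequalities between elements of $L^2(\mathbb R)$ are meant almost everywhere. **Theorem (Jaming–Powell, umbrella theorem).** Let $\varphi,\psi\in L^2(\mathbb R)$ be two fixed real-valued functions. There is an integer $N=N(\varphi,\psi)$ such that, if $(e_k)_{k\in I}$ is an orthonormal family in $L^2(\mathbb R)$, indexed by any set $I$, with $|e_k|\le\varphi$ and $|\widehat{e_k}|\le\psi$ for all $k\in I$, then $I$ is finite and $\#I\le N$. Moreover, the following explicit bounds hold. 1. (Gaussian case) Let $a,C>0$ and $\varphi(x)=\psi(x)=Ce^{-\pi a x^2}$. If $I\neq\emptyset$ and $(e_k)_{k\in I}$ is as above, then $$\#I\le 2+\frac{8}{\pi a}\max\left(1+\ln\frac{C}{a^{5/2}},\ \pi+\frac12\ln\frac{C^2}{2a}\right).$$ 2. (Polynomial case) Let $p>1/2$, $C>0$ and $\varphi(x)=\psi(x)=\dfrac{C}{(1+|x|)^p}$. If $(e_k)_{k\in I}$ is as above, then $$\#I\le 3^{8\left(\frac{20C}{\sqrt{2p-1}}\right)^{\frac{4}{2p-1}}}.$$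 Moreover, $$\#I\le 4\left(\frac{800C^2}{2p-1}\right)^{\frac{2}{2p-3}}\ \text{ if } p>\tfrac32,\qquad \#I\le 32\,(20C)^{\frac{2}{p-1}}\ \text{ if } 1<p\le\tfrac32.$$ -/

import Mathlib

open MeasureTheory
open scoped FourierTransform

universe u

/-- The family `e` is orthonormal in the complex Hilbert space `L²(ℝ)`, every `|e k|` is bounded by
`φ` and every Fourier transform `|𝓕 (e k)|` is bounded by `ψ`. Elements of `L²` are classes of
functions, so the two bounds are meant almost everywhere. Here `𝓕` is the unitary Fourier transform
of `L²(ℝ)`, which extends `∫ f(x) exp(-2πixξ) dx`. -/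
def IsUmbrellaFamily (φ ψ : ℝ → ℝ) {I : Type u} (e : I → Lp (α := ℝ) ℂ 2 volume) : Prop :=
  Orthonormal ℂ e ∧
    (∀ k, ∀ᵐ x : ℝ, ‖e k x‖ ≤ φ x) ∧
    (∀ k, ∀ᵐ ξ : ℝ, ‖(𝓕 (e k) : Lp (α := ℝ) ℂ 2 volume) ξ‖ ≤ ψ ξ)

/-! Only about |A||B| orthonormal functions can concentrate on A in time and on B in frequency. Cut
`e k` to A, transform, cut to B: by unitarity the norm stays at least 1 - α - β when the two
discarded pieces have norms at most α and β. The squares of these norms sum to at most |A||B|: for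
each ξ, Bessel's inequality against the exponential cut to A bounds the sum of the integrands by
|A|, and one integrates over B (`card_mul_sq_le_measure_mul_measure`). With A = B = [-T, T], the
envelopes control the discarded mass, and any T with small tails bounds the cardinality. The
explicit bounds come from computing tails and choosing T. A nonempty family forces the envelope to
have L² norm at least 1, which keeps these T nonnegative. -/

/-- Against a test function, both sides move the transform onto that function. This gives the
pointwise formula that Bessel's inequality needs. -/
theorem MeasureTheory.Lp.coeFn_fourier_of_integrable (f : Lp (α := ℝ) ℂ 2 volume)
    (hf : Integrable f) :
    ((𝓕 f : Lp (α := ℝ) ℂ 2 volume) : ℝ → ℂ) =ᵐ[volume] 𝓕 (f : ℝ → ℂ) := by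
  refine ae_eq_of_integral_contDiff_smul_eq
    ((Lp.memLp (𝓕 f)).locallyIntegrable Fact.out) ?_ fun g hg hgc => ?_
  · exact (VectorFourier.fourierIntegral_continuous Real.continuous_fourierChar
      (by fun_prop) hf).locallyIntegrable
  have h1 : HasCompactSupport (Complex.ofRealCLM ∘ g) := hgc.comp_left rfl
  have h2 : ContDiff ℝ (⊤ : ℕ∞) (Complex.ofRealCLM ∘ g) := by fun_prop
  set G : SchwartzMap ℝ ℂ := h1.toSchwartzMap h2 with hG
  have key := congrArg (fun u => u G) (Lp.fourier_toTemperedDistribution_eq f)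
  simp only [TemperedDistribution.fourier_apply, Lp.toTemperedDistribution_apply] at key
  have h3 : ∫ x, (𝓕 G) x • f x = ∫ x, G x • 𝓕 (f : ℝ → ℂ) x := by
    rw [SchwartzMap.fourier_coe]
    have h4 := VectorFourier.integral_fourierIntegral_smul_eq_flip (L := innerₗ ℝ)
      Real.continuous_fourierChar continuous_inner (G.integrable (μ := volume)) hf
    rwa [flip_innerₗ] at h4
  rw [h3] at key
  simpa [hG] using key.symm

/-! ### Time-frequency truncation -/

/-- Multiplication of an `L²` function by the indicator function of a measurable set. -/
noncomputable def indicatorLp {A : Set ℝ} (hA : MeasurableSet A) (f : Lp (α := ℝ) ℂ 2 volume) :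
    Lp (α := ℝ) ℂ 2 volume :=
  ((Lp.memLp f).indicator hA).toLp _

theorem coeFn_indicatorLp {A : Set ℝ} (hA : MeasurableSet A) (f : Lp (α := ℝ) ℂ 2 volume) :
    indicatorLp hA f =ᵐ[volume] A.indicator f :=
  MemLp.coeFn_toLp _

theorem norm_sq_eq_integral_norm_sq (f : Lp (α := ℝ) ℂ 2 volume) :
    ‖f‖ ^ 2 = ∫ x, ‖f x‖ ^ 2 := by
  have h := L2.inner_def (𝕜 := ℂ) f f
  rw [inner_self_eq_norm_sq_to_K] at h
  simp only [inner_self_eq_norm_sq_to_K] at h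
  have h' : ((‖f‖ ^ 2 : ℝ) : ℂ) = ((∫ x, ‖f x‖ ^ 2 : ℝ) : ℂ) := by
    rw [← integral_complex_ofReal]
    push_cast
    exact h
  exact_mod_cast h'

theorem norm_indicatorLp_sq {A : Set ℝ} (hA : MeasurableSet A) (f : Lp (α := ℝ) ℂ 2 volume) :
    ‖indicatorLp hA f‖ ^ 2 = ∫ x in A, ‖f x‖ ^ 2 := by
  rw [norm_sq_eq_integral_norm_sq, ← integral_indicator hA]
  refine integral_congr_ae ?_
  filter_upwards [coeFn_indicatorLp hA f] with x hx
  rw [hx]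
  by_cases h : x ∈ A <;> simp [h]

theorem integrable_norm_sq_coeFn (f : Lp (α := ℝ) ℂ 2 volume) :
    Integrable fun x => ‖f x‖ ^ 2 :=
  (memLp_two_iff_integrable_sq_norm (Lp.memLp f).1).1 (Lp.memLp f)

theorem norm_indicatorLp_le {A : Set ℝ} (hA : MeasurableSet A) (f : Lp (α := ℝ) ℂ 2 volume) :
    ‖indicatorLp hA f‖ ≤ ‖f‖ := by
  refine abs_le_of_sq_le_sq' ?_ (norm_nonneg f) |>.2
  rw [norm_indicatorLp_sq, norm_sq_eq_integral_norm_sq]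
  exact setIntegral_le_integral (integrable_norm_sq_coeFn f)
    (Filter.Eventually.of_forall fun x => by positivity)

theorem indicatorLp_sub {A : Set ℝ} (hA : MeasurableSet A) (f g : Lp (α := ℝ) ℂ 2 volume) :
    indicatorLp hA (f - g) = indicatorLp hA f - indicatorLp hA g := by
  ext1
  filter_upwards [coeFn_indicatorLp hA (f - g), coeFn_indicatorLp hA f, coeFn_indicatorLp hA g,
    Lp.coeFn_sub f g, Lp.coeFn_sub (indicatorLp hA f) (indicatorLp hA g)] with x h1 h2 h3 h4 h5
  rw [h1, h5, Pi.sub_apply, h2, h3]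
  by_cases h : x ∈ A
  · rw [Set.indicator_of_mem h, Set.indicator_of_mem h, Set.indicator_of_mem h]
    exact h4
  · simp [h]

theorem sub_indicatorLp {A : Set ℝ} (hA : MeasurableSet A) (f : Lp (α := ℝ) ℂ 2 volume) :
    f - indicatorLp hA f = indicatorLp hA.compl f := by
  ext1
  filter_upwards [coeFn_indicatorLp hA f, coeFn_indicatorLp hA.compl f,
    Lp.coeFn_sub f (indicatorLp hA f)] with x h1 h2 h3
  rw [h3, Pi.sub_apply, h1, h2]
  by_cases h : x ∈ A <;> simp [h]

/-- **Bessel's inequality** for truncated Fourier integrals. -/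
theorem sum_norm_fourier_indicator_sq_le {I : Type*} {e : I → Lp (α := ℝ) ℂ 2 volume}
    (he : Orthonormal ℂ e) (s : Finset I) {A : Set ℝ} (hA : MeasurableSet A)
    (hA' : volume A ≠ ⊤) (ξ : ℝ) :
    ∑ k ∈ s, ‖𝓕 (A.indicator (e k)) ξ‖ ^ 2 ≤ volume.real A := by
  -- Cut to A, this exponential has squared norm |A|, and its inner products with the `e k` are the
  -- truncated transforms at ξ.
  set c : ℝ → ℂ := fun x => Complex.exp ((2 * Real.pi * (x * ξ) : ℝ) * Complex.I) with hc
  have hcont : Continuous c := by fun_prop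
  have hnorm : ∀ x, ‖c x‖ = 1 := fun x => Complex.norm_exp_ofReal_mul_I _
  have hm : MemLp (A.indicator c) 2 volume := by
    rw [memLp_indicator_iff_restrict hA]
    have : IsFiniteMeasure (volume.restrict A) := ⟨by simpa using hA'.lt_top⟩
    exact MemLp.of_bound hcont.aestronglyMeasurable 1
      (Filter.Eventually.of_forall fun x => (hnorm x).le)
  set g : Lp (α := ℝ) ℂ 2 volume := hm.toLp _
  have hgc : g =ᵐ[volume] A.indicator c := hm.coeFn_toLp
  have hng : ‖g‖ ^ 2 = volume.real A := by
    rw [norm_sq_eq_integral_norm_sq, ← integral_indicator_one hA]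
    refine integral_congr_ae ?_
    filter_upwards [hgc] with x hx
    rw [hx]
    by_cases h : x ∈ A
    · simp only [h, Set.indicator_of_mem, hnorm, Pi.one_apply, one_pow]
    · simp [h]
  have hinner : ∀ k, 𝓕 (A.indicator (e k)) ξ = inner ℂ g (e k) := by
    intro k
    rw [L2.inner_def, Real.fourier_eq']
    refine integral_congr_ae ?_
    filter_upwards [hgc] with x hx
    rw [hx]
    by_cases h : x ∈ A
    · simp [h, hc, ← Complex.exp_conj, map_ofNat, mul_comm]
    · simp [h]
  calc ∑ k ∈ s, ‖𝓕 (A.indicator (e k)) ξ‖ ^ 2 = ∑ k ∈ s, ‖inner ℂ (e k) g‖ ^ 2 := by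
        simp_rw [hinner, norm_inner_symm g]
    _ ≤ ‖g‖ ^ 2 := he.sum_inner_products_le g
    _ = volume.real A := hng

theorem coeFn_fourier_indicatorLp {A : Set ℝ} (hA : MeasurableSet A) (hA' : volume A ≠ ⊤)
    (f : Lp (α := ℝ) ℂ 2 volume) :
    ((𝓕 (indicatorLp hA f) : Lp (α := ℝ) ℂ 2 volume) : ℝ → ℂ) =ᵐ[volume]
      𝓕 (A.indicator f) := by
  have hi : Integrable (A.indicator f) := by
    rw [integrable_indicator_iff hA]
    have : IsFiniteMeasure (volume.restrict A) := ⟨by simpa using hA'.lt_top⟩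
    exact ((Lp.memLp f).restrict A).integrable (by norm_num)
  have h := Lp.coeFn_fourier_of_integrable (indicatorLp hA f)
    (hi.congr (coeFn_indicatorLp hA f).symm)
  refine h.trans (Filter.Eventually.of_forall fun ξ => ?_)
  rw [Real.fourier_eq, Real.fourier_eq]
  refine integral_congr_ae ?_
  filter_upwards [coeFn_indicatorLp hA f] with x hx
  rw [hx]

/-- An orthonormal family concentrated on `A` in time and on `B` in frequency has at most about
`|A| |B|` elements. -/
theorem card_mul_sq_le_measure_mul_measure {I : Type*} {e : I → Lp (α := ℝ) ℂ 2 volume}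
    (he : Orthonormal ℂ e) (s : Finset I) {A B : Set ℝ} (hA : MeasurableSet A)
    (hB : MeasurableSet B) (hA' : volume A ≠ ⊤) (hB' : volume B ≠ ⊤) {α β : ℝ}
    (hα : 0 ≤ α) (hβ : 0 ≤ β) (hαβ : α + β ≤ 1)
    (h1 : ∀ k, ∫ x in Aᶜ, ‖e k x‖ ^ 2 ≤ α ^ 2)
    (h2 : ∀ k, ∫ ξ in Bᶜ, ‖(𝓕 (e k) : Lp (α := ℝ) ℂ 2 volume) ξ‖ ^ 2 ≤ β ^ 2) :
    s.card * (1 - α - β) ^ 2 ≤ volume.real A * volume.real B := by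
  have hlow : ∀ k, 1 - α - β ≤ ‖indicatorLp hB (𝓕 (indicatorLp hA (e k)))‖ := by
    intro k
    have h3 : ‖indicatorLp hA.compl (e k)‖ ≤ α :=
      abs_le_of_sq_le_sq' (by rw [norm_indicatorLp_sq]; exact h1 k) hα |>.2
    have h4 : ‖indicatorLp hB.compl (𝓕 (e k))‖ ≤ β :=
      abs_le_of_sq_le_sq' (by rw [norm_indicatorLp_sq]; exact h2 k) hβ |>.2
    have h5 : ‖𝓕 (e k) - 𝓕 (indicatorLp hA (e k))‖ ≤ α := by
      have : 𝓕 (e k) - 𝓕 (indicatorLp hA (e k)) = 𝓕 (e k - indicatorLp hA (e k)) :=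
        (map_sub (Lp.fourierTransformₗᵢ ℝ ℂ) _ _).symm
      rw [this, Lp.norm_fourier_eq, sub_indicatorLp]
      exact h3
    have h6 : ‖𝓕 (e k)‖ = 1 := by rw [Lp.norm_fourier_eq]; exact he.1 k
    have h7 := (norm_indicatorLp_le hB (𝓕 (e k) - 𝓕 (indicatorLp hA (e k)))).trans h5
    rw [indicatorLp_sub] at h7
    rw [← sub_indicatorLp hB] at h4
    have h8 := norm_sub_norm_le (𝓕 (e k)) (indicatorLp hB (𝓕 (e k)))
    have h9 := norm_sub_norm_le (indicatorLp hB (𝓕 (e k)))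
      (indicatorLp hB (𝓕 (indicatorLp hA (e k))))
    linarith
  have hint : ∀ k, IntegrableOn (fun ξ => ‖𝓕 (A.indicator (e k)) ξ‖ ^ 2) B := fun k =>
    ((integrable_norm_sq_coeFn (𝓕 (indicatorLp hA (e k)))).congr
      ((coeFn_fourier_indicatorLp hA hA' (e k)).fun_comp fun z => ‖z‖ ^ 2)).integrableOn
  calc s.card * (1 - α - β) ^ 2 = ∑ k ∈ s, (1 - α - β) ^ 2 := by simp
    _ ≤ ∑ k ∈ s, ‖indicatorLp hB (𝓕 (indicatorLp hA (e k)))‖ ^ 2 :=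
        Finset.sum_le_sum fun k _ => pow_le_pow_left₀ (by linarith) (hlow k) 2
    _ = ∑ k ∈ s, ∫ ξ in B, ‖𝓕 (A.indicator (e k)) ξ‖ ^ 2 := by
        refine Finset.sum_congr rfl fun k _ => ?_
        rw [norm_indicatorLp_sq]
        exact integral_congr_ae (ae_restrict_of_ae
          ((coeFn_fourier_indicatorLp hA hA' (e k)).fun_comp fun z => ‖z‖ ^ 2))
    _ = ∫ ξ in B, ∑ k ∈ s, ‖𝓕 (A.indicator (e k)) ξ‖ ^ 2 :=
        (integral_finsetSum s fun k _ => hint k).symm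
    _ ≤ ∫ _ in B, volume.real A := by
        refine integral_mono (integrable_finsetSum s fun k _ => hint k) ?_
          fun ξ => sum_norm_fourier_indicator_sq_le he s hA hA' ξ
        exact integrableOn_const hB'
    _ = volume.real A * volume.real B := by simp [mul_comm]

/-! ### Counting from the tails of the envelopes -/

namespace IsUmbrellaFamily

variable {φ ψ : ℝ → ℝ} {I : Type u} {e : I → Lp (α := ℝ) ℂ 2 volume}

theorem one_le_integral_sq (h : IsUmbrellaFamily φ ψ e) (hφ : Integrable fun x => φ x ^ 2)
    [Nonempty I] : 1 ≤ ∫ x, φ x ^ 2 := by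
  obtain ⟨k⟩ := ‹Nonempty I›
  have h1 : ‖e k‖ ^ 2 = 1 := by rw [h.1.1 k, one_pow]
  rw [← h1, norm_sq_eq_integral_norm_sq]
  refine integral_mono_ae (integrable_norm_sq_coeFn _) hφ ?_
  filter_upwards [h.2.1 k] with x hx
  exact pow_le_pow_left₀ (norm_nonneg _) hx 2

theorem finite_and_card_mul_sq_le (h : IsUmbrellaFamily φ ψ e)
    (hφ : Integrable fun x => φ x ^ 2) (hψ : Integrable fun x => ψ x ^ 2) {T ε : ℝ}
    (hT : 0 ≤ T) (hε : 0 ≤ ε) (hε' : ε < 1 / 2)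
    (h1 : ∫ x in (Set.Icc (-T) T)ᶜ, φ x ^ 2 ≤ ε ^ 2)
    (h2 : ∫ x in (Set.Icc (-T) T)ᶜ, ψ x ^ 2 ≤ ε ^ 2) :
    Finite I ∧ (Nat.card I : ℝ) * (1 - 2 * ε) ^ 2 ≤ 4 * T ^ 2 := by
  have hs : ∀ s : Finset I, (s.card : ℝ) * (1 - 2 * ε) ^ 2 ≤ 4 * T ^ 2 := by
    intro s
    have hvol : volume.real (Set.Icc (-T) T) = 2 * T := by
      rw [Real.volume_real_Icc_of_le (by linarith)]; ring
    have := card_mul_sq_le_measure_mul_measure h.1 s (A := Set.Icc (-T) T) (B := Set.Icc (-T) T)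
      measurableSet_Icc measurableSet_Icc measure_Icc_lt_top.ne measure_Icc_lt_top.ne hε hε
      (by linarith)
      (fun k => (integral_mono_ae (integrable_norm_sq_coeFn _).integrableOn hφ.integrableOn
        ?_).trans h1)
      (fun k => (integral_mono_ae (integrable_norm_sq_coeFn _).integrableOn hψ.integrableOn
        ?_).trans h2)
    · rw [hvol] at this
      linarith
    · filter_upwards [ae_restrict_of_ae (h.2.1 k)] with x hx
      exact pow_le_pow_left₀ (norm_nonneg _) hx 2
    · filter_upwards [ae_restrict_of_ae (h.2.2 k)] with x hx
      exact pow_le_pow_left₀ (norm_nonneg _) hx 2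
  have hpos : 0 < (1 - 2 * ε) ^ 2 := pow_pos (by linarith) 2
  have hfin : Finite I := by
    by_contra hinf
    rw [not_finite_iff_infinite] at hinf
    obtain ⟨n, hn⟩ := exists_nat_gt (4 * T ^ 2 / (1 - 2 * ε) ^ 2)
    obtain ⟨s, hsn⟩ := Infinite.exists_subset_card_eq I n
    have := hs s
    rw [div_lt_iff₀ hpos] at hn
    rw [hsn] at this
    linarith
  refine ⟨hfin, ?_⟩
  have := Fintype.ofFinite I
  simpa [Nat.card_eq_fintype_card] using hs Finset.univ

theorem finite_and_card_le (h : IsUmbrellaFamily φ ψ e)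
    (hφ : Integrable fun x => φ x ^ 2) (hψ : Integrable fun x => ψ x ^ 2) {T : ℝ} (hT : 0 ≤ T)
    (h1 : ∫ x in (Set.Icc (-T) T)ᶜ, φ x ^ 2 ≤ 1 / 64)
    (h2 : ∫ x in (Set.Icc (-T) T)ᶜ, ψ x ^ 2 ≤ 1 / 64) :
    Finite I ∧ (Nat.card I : ℝ) ≤ 8 * T ^ 2 := by
  -- ε = 1/8 gives the constant 4 / (3/4)² = 64/9 ≤ 8.
  obtain ⟨hf, hc⟩ := h.finite_and_card_mul_sq_le hφ hψ (ε := 1 / 8) hT (by norm_num) (by norm_num)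
    (h1.trans (by norm_num)) (h2.trans (by norm_num))
  refine ⟨hf, ?_⟩
  norm_num at hc
  have : (0 : ℝ) ≤ Nat.card I := Nat.cast_nonneg _
  linarith

end IsUmbrellaFamily

/-! ### Tail integrals -/

theorem exists_integral_compl_Icc_le {f : ℝ → ℝ} (hf : Integrable f) {δ : ℝ} (hδ : 0 < δ) :
    ∃ T₀ : ℝ, ∀ T, T₀ ≤ T → ∫ x in (Set.Icc (-T) T)ᶜ, f x ≤ δ := by
  have h := tendsto_setIntegral_of_antitone (μ := volume) (f := f)
    (s := fun T : ℝ => (Set.Icc (-T) T)ᶜ) (fun _ => measurableSet_Icc.compl)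
    (fun S T hST => Set.compl_subset_compl.2 (Set.Icc_subset_Icc (neg_le_neg hST) hST))
    ⟨0, hf.integrableOn⟩
  have hempty : ⋂ T : ℝ, (Set.Icc (-T) T)ᶜ = ∅ := by
    refine Set.eq_empty_of_forall_notMem fun x hx => ?_
    exact Set.mem_iInter.1 hx |x| ⟨neg_abs_le x, le_abs_self x⟩
  rw [hempty, setIntegral_empty] at h
  exact Filter.eventually_atTop.1 (h.eventually_le_const hδ)

theorem exists_card_bound_of_memLp {φ ψ : ℝ → ℝ} (hφ : MemLp φ 2 volume)
    (hψ : MemLp ψ 2 volume) :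
    ∃ N : ℕ, ∀ (I : Type u) (e : I → Lp (α := ℝ) ℂ 2 volume),
      IsUmbrellaFamily φ ψ e → Finite I ∧ Nat.card I ≤ N := by
  obtain ⟨T₁, h1⟩ := exists_integral_compl_Icc_le hφ.integrable_sq (δ := 1 / 64) (by norm_num)
  obtain ⟨T₂, h2⟩ := exists_integral_compl_Icc_le hψ.integrable_sq (δ := 1 / 64) (by norm_num)
  set T := max 0 (max T₁ T₂) with hT
  refine ⟨⌊8 * T ^ 2⌋₊, fun I e he => ?_⟩
  obtain ⟨hf, hc⟩ := he.finite_and_card_le hφ.integrable_sq hψ.integrable_sq (T := T)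
    (le_max_left _ _) (h1 T (by simp [hT])) (h2 T (by simp [hT]))
  exact ⟨hf, Nat.le_floor hc⟩

theorem setIntegral_compl_Icc_comp_abs (g : ℝ → ℝ) {T : ℝ} (hT : 0 ≤ T) :
    ∫ x in (Set.Icc (-T) T)ᶜ, g |x| = 2 * ∫ x in Set.Ioi T, g x := by
  have h := integral_comp_abs (f := (Set.Ioi T).indicator g)
  rw [setIntegral_indicator measurableSet_Ioi,
    Set.inter_eq_right.2 (Set.Ioi_subset_Ioi hT)] at h
  rw [← h, ← integral_indicator measurableSet_Icc.compl]
  refine integral_congr_ae (Filter.Eventually.of_forall fun x => ?_)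
  simp only [Set.indicator, Set.mem_compl_iff, Set.mem_Icc, ← abs_le, Set.mem_Ioi, not_le]

/-- Shift by T and use (x + T)² ≥ x² + T² for x, T ≥ 0. -/
theorem integral_compl_Icc_gaussian_le {b : ℝ} (hb : 0 < b) {T : ℝ} (hT : 0 ≤ T) :
    ∫ x in (Set.Icc (-T) T)ᶜ, Real.exp (-b * x ^ 2) ≤
      Real.exp (-b * T ^ 2) * √(Real.pi / b) := by
  have h1 := setIntegral_compl_Icc_comp_abs (fun x => Real.exp (-b * x ^ 2)) hT
  simp only [sq_abs] at h1
  have h2 : ∫ x in Set.Ioi T, Real.exp (-b * x ^ 2) =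
      ∫ x in Set.Ioi 0, Real.exp (-b * (x + T) ^ 2) := by
    rw [← integral_indicator measurableSet_Ioi, ← integral_indicator measurableSet_Ioi,
      ← integral_add_right_eq_self _ T]
    refine integral_congr_ae (Filter.Eventually.of_forall fun x => ?_)
    simp [Set.indicator]
  have hi := integrable_exp_neg_mul_sq hb
  have h3 : ∫ x in Set.Ioi 0, Real.exp (-b * (x + T) ^ 2) ≤
      ∫ x in Set.Ioi 0, Real.exp (-b * T ^ 2) * Real.exp (-b * x ^ 2) := by
    refine setIntegral_mono_on (hi.comp_add_right T).integrableOn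
      (hi.const_mul _).integrableOn measurableSet_Ioi fun x hx => ?_
    rw [← Real.exp_add, Real.exp_le_exp]
    have : 0 ≤ b * (x * T) := mul_nonneg hb.le (mul_nonneg (le_of_lt hx) hT)
    linarith
  rw [integral_const_mul, integral_gaussian_Ioi] at h3
  rw [h1, h2]
  linarith

theorem integral_Ioi_one_add_rpow {p : ℝ} (hp : 1 / 2 < p) {T : ℝ} (hT : 0 ≤ T) :
    ∫ x in Set.Ioi T, (1 + x) ^ (-(2 * p)) = (1 + T) ^ (-(2 * p - 1)) / (2 * p - 1) := by
  have h : ∫ x in Set.Ioi (1 + T), x ^ (-(2 * p)) =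
      ∫ x in Set.Ioi T, (1 + x) ^ (-(2 * p)) := by
    rw [← integral_indicator measurableSet_Ioi, ← integral_indicator measurableSet_Ioi,
      ← integral_add_left_eq_self _ 1]
    refine integral_congr_ae (Filter.Eventually.of_forall fun x => ?_)
    simp [Set.indicator]
  rw [← h, integral_Ioi_rpow_of_lt (by linarith) (by linarith),
    show -(2 * p) + 1 = -(2 * p - 1) by ring, neg_div_neg_eq]

theorem integral_compl_Icc_one_add_abs_rpow {p : ℝ} (hp : 1 / 2 < p) {T : ℝ} (hT : 0 ≤ T) :
    ∫ x in (Set.Icc (-T) T)ᶜ, (1 + |x|) ^ (-(2 * p)) =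
      2 * ((1 + T) ^ (-(2 * p - 1)) / (2 * p - 1)) := by
  rw [setIntegral_compl_Icc_comp_abs (fun x => (1 + x) ^ (-(2 * p))) hT,
    integral_Ioi_one_add_rpow hp hT]

theorem integral_one_add_abs_rpow {p : ℝ} (hp : 1 / 2 < p) :
    ∫ x : ℝ, (1 + |x|) ^ (-(2 * p)) = 2 / (2 * p - 1) := by
  rw [integral_comp_abs (f := fun x => (1 + x) ^ (-(2 * p))),
    integral_Ioi_one_add_rpow hp le_rfl, add_zero, Real.one_rpow, mul_one_div]

/-! ### Explicit bounds -/

namespace IsUmbrellaFamily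

variable {I : Type u} {e : I → Lp (α := ℝ) ℂ 2 volume}

theorem gaussian_bound {a C : ℝ} (ha : 0 < a) (hC : 0 < C) [Nonempty I]
    (h : IsUmbrellaFamily (fun x => C * Real.exp (-Real.pi * a * x ^ 2))
      (fun ξ => C * Real.exp (-Real.pi * a * ξ ^ 2)) e) :
    Finite I ∧ (Nat.card I : ℝ) ≤
      2 + 8 / (Real.pi * a) * (Real.pi + 1 / 2 * Real.log (C ^ 2 / (2 * a))) := by
  have hpi := Real.pi_gt_three
  set b := 2 * Real.pi * a with hb
  have hb0 : 0 < b := by positivity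
  have hsq : (fun x : ℝ => (C * Real.exp (-Real.pi * a * x ^ 2)) ^ 2) =
      fun x => C ^ 2 * Real.exp (-b * x ^ 2) := by
    funext x
    rw [mul_pow, ← Real.exp_nat_mul]
    congr 2
    push_cast
    ring
  have hint : Integrable fun x : ℝ => (C * Real.exp (-Real.pi * a * x ^ 2)) ^ 2 := by
    rw [hsq]
    exact (integrable_exp_neg_mul_sq hb0).const_mul _
  set G := C ^ 2 * √(Real.pi / b) with hG
  have hG1 : 1 ≤ G := by
    have := h.one_le_integral_sq hint
    rwa [hsq, integral_const_mul, integral_gaussian] at this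
  have hlog : 0 ≤ Real.log (64 * G) := Real.log_nonneg (by linarith)
  -- Chosen so that the tail bound G exp(-bT²) equals 1/64, where G is the total mass of the squared
  -- envelope.
  set T := √(Real.log (64 * G) / b) with hT
  have hT2 : T ^ 2 = Real.log (64 * G) / b := Real.sq_sqrt (by positivity)
  have htail : ∫ x in (Set.Icc (-T) T)ᶜ, (C * Real.exp (-Real.pi * a * x ^ 2)) ^ 2 ≤ 1 / 64 := by
    rw [hsq, integral_const_mul]
    have h1 := integral_compl_Icc_gaussian_le hb0 (T := T) (Real.sqrt_nonneg _)
    have h2 : Real.exp (-b * T ^ 2) = (64 * G)⁻¹ := by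
      rw [hT2, ← Real.exp_log (show 0 < 64 * G by linarith), ← Real.exp_neg, Real.log_exp]
      congr 1
      field_simp
    rw [h2] at h1
    calc _ ≤ C ^ 2 * ((64 * G)⁻¹ * √(Real.pi / b)) := by gcongr
      _ = (64 * G)⁻¹ * G := by rw [hG]; ring
      _ = 1 / 64 := by field_simp
  obtain ⟨hf, hc⟩ := h.finite_and_card_le hint hint (T := T) (Real.sqrt_nonneg _) htail htail
  refine ⟨hf, hc.trans ?_⟩
  have hlogG : Real.log (64 * G) =
      6 * Real.log 2 + Real.log (C ^ 2) - 1 / 2 * Real.log (2 * a) := by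
    have h1 : Real.pi / b = (2 * a)⁻¹ := by rw [hb]; field_simp
    rw [hG, h1, Real.log_mul (by norm_num) (by positivity), Real.log_mul (by positivity)
      (by positivity), Real.log_sqrt (by positivity), Real.log_inv,
      show (64 : ℝ) = 2 ^ 6 by norm_num, Real.log_pow]
    push_cast
    ring
  have hl : Real.log (2 * a) ≤ 2 * a - 1 := Real.log_le_sub_one_of_pos (by positivity)
  have h2 := Real.log_two_lt_d9
  rw [hT2, hlogG, Real.log_div (by positivity) (by positivity), ← sub_nonneg]
  have : 2 + 8 / (Real.pi * a) * (Real.pi + 1 / 2 * (Real.log (C ^ 2) - Real.log (2 * a))) -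
      8 * ((6 * Real.log 2 + Real.log (C ^ 2) - 1 / 2 * Real.log (2 * a)) / b) =
      (2 * Real.pi * a + 8 * Real.pi - 24 * Real.log 2 - 2 * Real.log (2 * a)) /
        (Real.pi * a) := by
    rw [hb]
    field_simp
    ring
  rw [this]
  refine div_nonneg ?_ (by positivity)
  have : 3 * a ≤ Real.pi * a := by gcongr
  linarith

section Polynomial

variable {p C : ℝ}

theorem sq_div_one_add_abs_rpow :
    (fun x : ℝ => (C / (1 + |x|) ^ p) ^ 2) = fun x => C ^ 2 * (1 + |x|) ^ (-(2 * p)) := by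
  funext x
  have : 0 ≤ 1 + |x| := by positivity
  rw [div_pow, ← Real.rpow_mul_natCast this, Real.rpow_neg this, div_eq_mul_inv]
  congr 3
  push_cast
  ring

theorem integrable_sq_div_one_add_abs_rpow (hp : 1 / 2 < p) :
    Integrable fun x : ℝ => (C / (1 + |x|) ^ p) ^ 2 := by
  rw [sq_div_one_add_abs_rpow]
  exact (integrable_one_add_norm (E := ℝ) (r := 2 * p) (by simp; linarith)).const_mul _

theorem integral_compl_Icc_sq_div_one_add_abs_rpow (hp : 1 / 2 < p) {T : ℝ} (hT : 0 ≤ T) :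
    ∫ x in (Set.Icc (-T) T)ᶜ, (C / (1 + |x|) ^ p) ^ 2 =
      2 * C ^ 2 / (2 * p - 1) * (1 + T) ^ (-(2 * p - 1)) := by
  rw [sq_div_one_add_abs_rpow, integral_const_mul, integral_compl_Icc_one_add_abs_rpow hp hT]
  ring

variable (h : IsUmbrellaFamily (fun x => C / (1 + |x|) ^ p) (fun ξ => C / (1 + |ξ|) ^ p) e)
include h

theorem one_le_of_polynomial (hp : 1 / 2 < p) [Nonempty I] : 1 ≤ 2 * C ^ 2 / (2 * p - 1) := by
  have := h.one_le_integral_sq (integrable_sq_div_one_add_abs_rpow hp)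
  rw [sq_div_one_add_abs_rpow, integral_const_mul, integral_one_add_abs_rpow hp] at this
  linarith [show C ^ 2 * (2 / (2 * p - 1)) = 2 * C ^ 2 / (2 * p - 1) by ring]

theorem polynomial_bound (hp : 1 / 2 < p) [Nonempty I] :
    Finite I ∧ (Nat.card I : ℝ) ≤ 8 * (128 * C ^ 2 / (2 * p - 1)) ^ (2 / (2 * p - 1)) := by
  have hM := h.one_le_of_polynomial hp
  have hq : 0 < 2 * p - 1 := by linarith
  set D := 128 * C ^ 2 / (2 * p - 1) with hD
  have hDM : 2 * C ^ 2 / (2 * p - 1) = D / 64 := by rw [hD]; ring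
  have hD1 : 1 ≤ D := by linarith
  -- With T = y - 1 the tail is (D / 64) y^(-(2p-1)), exactly 1/64.
  set y := D ^ (1 / (2 * p - 1)) with hy
  have hy1 : 1 ≤ y := Real.one_le_rpow hD1 (by positivity)
  have htail : ∫ x in (Set.Icc (-(y - 1)) (y - 1))ᶜ, (C / (1 + |x|) ^ p) ^ 2 ≤ 1 / 64 := by
    rw [integral_compl_Icc_sq_div_one_add_abs_rpow hp (by linarith), hDM, add_sub_cancel, hy,
      ← Real.rpow_mul (by linarith), mul_neg, one_div_mul_cancel hq.ne', Real.rpow_neg_one]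
    field_simp
    exact le_rfl
  obtain ⟨hf, hc⟩ := h.finite_and_card_le (integrable_sq_div_one_add_abs_rpow hp)
    (integrable_sq_div_one_add_abs_rpow hp) (by linarith) htail htail
  refine ⟨hf, hc.trans ?_⟩
  have : D ^ (2 / (2 * p - 1)) = y ^ 2 := by
    rw [hy, ← Real.rpow_mul_natCast (by linarith)]
    congr 1
    push_cast
    ring
  rw [this]
  nlinarith

/-- Here ε varies with T = y - 1. Taking ε = 1/(20y) gives (1 - 2ε)y = y - 1/10 ≥ T, so the loss
1/(1 - 2ε)² is absorbed in passing from T to y. The tail must then be 1/(400y²), whence the 800 and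
the exponent 2p - 3. -/
theorem polynomial_bound_of_three_halves_lt (hp : 3 / 2 < p) [Nonempty I] :
    (Nat.card I : ℝ) ≤ 4 * (800 * C ^ 2 / (2 * p - 1)) ^ (2 / (2 * p - 3)) := by
  have hp' : 1 / 2 < p := by linarith
  have hM := h.one_le_of_polynomial hp'
  have hq : 0 < 2 * p - 3 := by linarith
  set D := 800 * C ^ 2 / (2 * p - 1) with hD
  have hDM : 2 * C ^ 2 / (2 * p - 1) = D / 400 := by rw [hD]; ring
  have hD1 : 1 ≤ D := by linarith
  set y := D ^ (1 / (2 * p - 3)) with hy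
  have hy1 : 1 ≤ y := Real.one_le_rpow hD1 (by positivity)
  have hyD : y ^ (2 * p - 3) = D := by
    rw [hy, ← Real.rpow_mul (by linarith), one_div_mul_cancel hq.ne', Real.rpow_one]
  have htail : ∫ x in (Set.Icc (-(y - 1)) (y - 1))ᶜ, (C / (1 + |x|) ^ p) ^ 2 ≤
      (1 / (20 * y)) ^ 2 := by
    rw [integral_compl_Icc_sq_div_one_add_abs_rpow hp' (by linarith), hDM, add_sub_cancel,
      show -(2 * p - 1) = -(2 * p - 3) - (2 : ℕ) by push_cast; ring,
      Real.rpow_sub_natCast (by linarith), Real.rpow_neg (by linarith), hyD]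
    field_simp
    norm_num
  have hε : 1 / (20 * y) ≤ 1 / 20 := by gcongr; linarith
  have hc := (h.finite_and_card_mul_sq_le (integrable_sq_div_one_add_abs_rpow hp')
    (integrable_sq_div_one_add_abs_rpow hp') (by linarith) (by positivity) (by linarith)
    htail htail).2
  have hDy : D ^ (2 / (2 * p - 3)) = y ^ 2 := by
    rw [hy, ← Real.rpow_mul_natCast (by linarith)]
    congr 1
    push_cast
    ring
  have hlow : y - 1 ≤ (1 - 2 * (1 / (20 * y))) * y := by field_simp; linarith
  have hpos : 0 < 1 - 2 * (1 / (20 * y)) := by linarith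
  rw [hDy]
  refine le_of_mul_le_mul_right (hc.trans ?_) (pow_pos hpos 2)
  have := pow_le_pow_left₀ (by linarith) hlow 2
  rw [mul_pow] at this
  linarith

theorem polynomial_bound_three_pow (hp : 1 / 2 < p) (hC : 0 < C) [Nonempty I] :
    (Nat.card I : ℝ) ≤ (3 : ℝ) ^ (8 * (20 * C / √(2 * p - 1)) ^ (4 / (2 * p - 1))) := by
  have hq : 0 < 2 * p - 1 := by linarith
  set X := (20 * C / √(2 * p - 1)) ^ (4 / (2 * p - 1)) with hX
  have hle : (128 * C ^ 2 / (2 * p - 1)) ^ (2 / (2 * p - 1)) ≤ X := by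
    have h1 : X = ((20 * C / √(2 * p - 1)) ^ 2) ^ (2 / (2 * p - 1)) := by
      rw [hX, ← Real.rpow_natCast_mul (by positivity)]
      congr 1
      push_cast
      ring
    rw [h1, div_pow, Real.sq_sqrt hq.le]
    -- Room to spare: 128 ≤ 20² = 400.
    gcongr
    nlinarith
  have hlog : 1 ≤ Real.log 3 := by
    rw [Real.le_log_iff_exp_le (by norm_num)]
    linarith [Real.exp_one_lt_d9]
  have hX0 : 0 ≤ X := by positivity
  calc (Nat.card I : ℝ) ≤ 8 * X := by linarith [(h.polynomial_bound hp).2]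
    _ ≤ Real.log 3 * (8 * X) := by nlinarith
    _ ≤ Real.exp (Real.log 3 * (8 * X)) := by linarith [Real.add_one_le_exp (Real.log 3 * (8 * X))]
    _ = 3 ^ (8 * X) := (Real.rpow_def_of_pos (by norm_num) _).symm

theorem polynomial_bound_of_one_lt (hp : 1 < p) (hC : 0 < C) [Nonempty I] :
    (Nat.card I : ℝ) ≤ 32 * (20 * C) ^ (2 / (p - 1)) := by
  have hp' : 1 / 2 < p := by linarith
  have hq : 0 < 2 * p - 1 := by linarith
  have hr : 0 < p - 1 := by linarith
  have hM := h.one_le_of_polynomial hp'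
  rw [le_div_iff₀ hq] at hM
  -- The mass condition gives 2C² ≥ 2p - 1 > 1; the base being at least 1, the exponent may be
  -- enlarged.
  have hC1 : 1 ≤ 20 * C := by nlinarith
  have hle : (128 * C ^ 2 / (2 * p - 1)) ^ (2 / (2 * p - 1)) ≤ (20 * C) ^ (2 / (p - 1)) := by
    calc (128 * C ^ 2 / (2 * p - 1)) ^ (2 / (2 * p - 1))
        ≤ ((20 * C) ^ 2) ^ (2 / (2 * p - 1)) := by
          gcongr
          rw [div_le_iff₀ hq]
          nlinarith [sq_nonneg C]
      _ = (20 * C) ^ (4 / (2 * p - 1)) := by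
          rw [← Real.rpow_natCast_mul (by positivity)]
          congr 1
          push_cast
          ring
      _ ≤ (20 * C) ^ (2 / (p - 1)) := by
          refine Real.rpow_le_rpow_of_exponent_le hC1 ?_
          rw [div_le_div_iff₀ hq hr]
          linarith
  have : 0 ≤ (20 * C) ^ (2 / (p - 1)) := by positivity
  linarith [(h.polynomial_bound hp').2]

end Polynomial

end IsUmbrellaFamily

theorem mainTheorem3 :
    -- the umbrella theorem
    (∀ φ ψ : ℝ → ℝ, MemLp φ 2 volume → MemLp ψ 2 volume →
      ∃ N : ℕ, ∀ (I : Type u) (e : I → Lp (α := ℝ) ℂ 2 volume),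
        IsUmbrellaFamily φ ψ e → Finite I ∧ Nat.card I ≤ N) ∧
    -- Gaussian bounds
    (∀ a C : ℝ, 0 < a → 0 < C →
      ∀ (I : Type u) (e : I → Lp (α := ℝ) ℂ 2 volume), Nonempty I →
        IsUmbrellaFamily (fun x => C * Real.exp (-Real.pi * a * x ^ 2))
          (fun ξ => C * Real.exp (-Real.pi * a * ξ ^ 2)) e →
        Finite I ∧
        (Nat.card I : ℝ) ≤ 2 + 8 / (Real.pi * a) *
          max (1 + Real.log (C / a ^ (5 / 2 : ℝ)))
            (Real.pi + 1 / 2 * Real.log (C ^ 2 / (2 * a)))) ∧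
    -- polynomially decaying bounds
    (∀ p C : ℝ, 1 / 2 < p → 0 < C →
      ∀ (I : Type u) (e : I → Lp (α := ℝ) ℂ 2 volume),
        IsUmbrellaFamily (fun x => C / (1 + |x|) ^ p) (fun ξ => C / (1 + |ξ|) ^ p) e →
        Finite I ∧
        (Nat.card I : ℝ) ≤
          (3 : ℝ) ^ (8 * (20 * C / Real.sqrt (2 * p - 1)) ^ (4 / (2 * p - 1))) ∧
        (3 / 2 < p →
          (Nat.card I : ℝ) ≤ 4 * (800 * C ^ 2 / (2 * p - 1)) ^ (2 / (2 * p - 3))) ∧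
        (1 < p → p ≤ 3 / 2 →
          (Nat.card I : ℝ) ≤ 32 * (20 * C) ^ (2 / (p - 1)))) := by
  refine ⟨fun φ ψ hφ hψ => exists_card_bound_of_memLp hφ hψ, fun a C ha hC I e _ h => ?_,
    fun p C hp hC I e h => ?_⟩
  · obtain ⟨hf, hc⟩ := h.gaussian_bound ha hC
    refine ⟨hf, hc.trans ?_⟩
    -- The second entry of the maximum already suffices.
    gcongr
    exact le_max_right _ _
  · have hq : 0 < 2 * p - 1 := by linarith
    rcases isEmpty_or_nonempty I with hI | hI
    · rw [Nat.card_of_isEmpty, Nat.cast_zero]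
      exact ⟨inferInstance, by positivity, fun _ => by positivity, fun _ _ => by positivity⟩
    · exact ⟨(h.polynomial_bound hp).1, h.polynomial_bound_three_pow hp hC,
        fun hp1 => h.polynomial_bound_of_three_halves_lt hp1,
        fun hp1 _ => h.polynomial_bound_of_one_lt hp1 hC⟩
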